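/- Let $p>0$ and $q\ge 0$ be integers, and let $\mathbf b$ be a symmetric bilinear form of signature $(p,q+1)$ on $\mathbb R^{p+q+1}=\mathbb R^{p,q+1}$. The pseudo-hyperbolic space is $\mathbb H^{p,q}=\{[x]\in\mathbb P(\mathbb R^{p,q+1}) : \mathbf b(x,x)<0\}=\{x\in\mathbb R^{p,q+1} : \mathbf b(x,x)=-1\}/\{\pm\mathrm{id}\}$, endowed with the pseudo-Riemannian metric of signature $(p,q)$ induced by $\mathbf b$ and with the volume of this metric (of density $\sqrt{|\det(g_{ij})|}$ in local coordinates). Its projective boundary is $\partial\mathbb H^{p,q}=\{[x] : \mathbf b(x,x)=0\}$. A lift of a set $\Lambda\subset\mathbb P(\mathbb R^{p,q+1})$ is a choice, for every line $\xi\in\Lambda$, of a nonzero vector $s(\xi)\in\xi$. It is positive if the convex hull of $s(\Lambda)$ does not contain $0$ and $\mathbf b(s(\xi),s(\eta))\le 0$ for all $\xi,\eta\in\Lambda$; then $\mathrm{Conv}(s)$ denotes the interior, in $\mathbb P(\mathbb R^{p,q+1})$, of the projectivization of the convex hull of $s(\Lambda)$. It is an open subset of $\mathbb H^{p,q}$,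 called a convex hull of $\Lambda$. A simplex of $\mathbb H^{p,q}$ is a set $\Lambda$ of $p+q+1$ points of $\mathbb P(\mathbb R^{p,q+1})$ that spans $\mathbb R^{p,q+1}$, admits a positive lift, and each of whose points is extremal in a convex hull of $\Lambda$ (it is not a convex combination of the other points). All convex hulls of a simplex $\Lambda$ are isometric, and the volume of $\Lambda$ is the volume of any of them. The simplex $\Lambda$ is ideal if $\Lambda\subset\partial\mathbb H^{p,q}$. **Corollary.** Every ideal simplex $\Lambda$ of $\mathbb H^{2,2}$ has finite volume: for every positive lift $s$ of $\Lambda$, the open set $\mathrm{Conv}(s)\subset\mathbb H^{2,2}$ has finite volume. -/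

import Mathlib

open scoped LinearAlgebra.Projectivization ContDiff ENNReal

noncomputable section

namespace PseudoHyperbolic

/-- The underlying real vector space of `ℝ^{p,q+1}`. -/
abbrev PQ (p q : ℕ) : Type := Fin p ⊕ Fin (q + 1) → ℝ

variable {p q : ℕ}

/-- The standard symmetric bilinear form of signature `(p, q+1)` on `ℝ^{p,q+1}`. -/
def b (x y : PQ p q) : ℝ :=
  ∑ i : Fin p, x (Sum.inl i) * y (Sum.inl i) - ∑ j : Fin (q + 1), x (Sum.inr j) * y (Sum.inr j)

/-- The projective space of `ℝ^{p,q+1}` carries the quotient topology. -/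
instance : TopologicalSpace (ℙ ℝ (PQ p q)) :=
  TopologicalSpace.coinduced (Projectivization.mk' ℝ) inferInstance

/-- The projectivization of a set of vectors: the set of lines spanned by its nonzero elements. -/
def projSet (A : Set (PQ p q)) : Set (ℙ ℝ (PQ p q)) :=
  {ξ | ∃ x ∈ A, ∃ hx : x ≠ 0, Projectivization.mk ℝ x hx = ξ}

/-! ### The pseudo-Riemannian volume -/

/-- A smooth local parametrization of the pseudo-hyperbolic space `H^{p,q}`, the quotient by `± id`
of the hyperquadric `b x x = -1`, given through a lift to this hyperquadric: on the open set
`source` of `ℝ^{p+q}`, it is a smooth immersion, and it is injective modulo `± id`. -/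
structure Parametrization (p q : ℕ) where
  source : Set (Fin (p + q) → ℝ)
  toFun : (Fin (p + q) → ℝ) → PQ p q
  isOpen_source : IsOpen source
  contDiffOn : ContDiffOn ℝ ∞ toFun source
  mem_quadric : ∀ u ∈ source, b (toFun u) (toFun u) = -1
  immersive : ∀ u ∈ source, Function.Injective (fderiv ℝ toFun u)
  injective : ∀ u ∈ source, ∀ v ∈ source, toFun u = toFun v ∨ toFun u = -toFun v → u = v

/-- The matrix `g_{ij} = b (∂_i φ, ∂_j φ)` of the pseudo-Riemannian metric in the coordinates given
by the parametrization `φ`. -/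
def Parametrization.metricMatrix (φ : Parametrization p q) (u : Fin (p + q) → ℝ) :
    Matrix (Fin (p + q)) (Fin (p + q)) ℝ :=
  Matrix.of fun i j =>
    b (fderiv ℝ φ.toFun u (Pi.single i 1)) (fderiv ℝ φ.toFun u (Pi.single j 1))

/-- A Borel set contained in the domain of a local parametrization, which encodes a Borel piece of
`H^{p,q}`. -/
structure Piece (p q : ℕ) where
  param : Parametrization p q
  dom : Set (Fin (p + q) → ℝ)
  measurableSet_dom : MeasurableSet dom
  dom_subset : dom ⊆ param.source

/-- The subset of `H^{p,q}` that is parametrized by a piece. -/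
def Piece.image (P : Piece p q) : Set (ℙ ℝ (PQ p q)) := projSet (P.param.toFun '' P.dom)

/-- The volume of a piece, computed in coordinates as `∫ √|det g_{ij}|`. -/
def Piece.vol (P : Piece p q) : ℝ≥0∞ :=
  ∫⁻ u in P.dom, ENNReal.ofReal √|(P.param.metricMatrix u).det|

/-- The pseudo-Riemannian volume on `H^{p,q}`: the outer measure of `A` is the infimum of the total
volume of countable families of parametrized Borel pieces that cover `A`. The coordinate volumes
agree in all parametrizations, and so on Borel sets (in particular on open sets) of `H^{p,q}` this
is the measure whose density in every chart is `√|det g_{ij}|`. It is `∞` on a set that is not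
contained in `H^{p,q}`. -/
def volume (A : Set (ℙ ℝ (PQ p q))) : ℝ≥0∞ :=
  ⨅ (P : ℕ → Piece p q) (_ : A ⊆ ⋃ n, (P n).image), ∑' n, (P n).vol

/-! ### Lifts, convex hulls, simplices -/

/-- A lift of `Λ`: the choice of a nonzero vector in every line that belongs to `Λ`. -/
def IsLift (Λ : Set (ℙ ℝ (PQ p q))) (s : Λ → PQ p q) : Prop :=
  ∀ ξ : Λ, ∃ h : s ξ ≠ 0, Projectivization.mk ℝ (s ξ) h = ξ

/-- A positive lift. -/
def IsPositiveLift (Λ : Set (ℙ ℝ (PQ p q))) (s : Λ → PQ p q) : Prop :=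
  IsLift Λ s ∧ (0 : PQ p q) ∉ convexHull ℝ (Set.range s) ∧ ∀ ξ η : Λ, b (s ξ) (s η) ≤ 0

/-- The convex hull of `Λ` determined by a positive lift `s`: the interior, in projective space, of
the projectivization of the convex hull of the vectors `s ξ`. -/
def Conv {Λ : Set (ℙ ℝ (PQ p q))} (s : Λ → PQ p q) : Set (ℙ ℝ (PQ p q)) :=
  interior (projSet (convexHull ℝ (Set.range s)))

/-- A polytope of `H^{p,q}`: a finite set of points of projective space that has a positive lift
and all of whose points are extremal in a convex hull of it, that is, none of them is a convex
combination of the others. -/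
def IsPolytope (Λ : Set (ℙ ℝ (PQ p q))) : Prop :=
  Λ.Finite ∧ ∃ s : Λ → PQ p q, IsPositiveLift Λ s ∧
    ∀ ξ : Λ, (ξ : ℙ ℝ (PQ p q)) ∉ projSet (convexHull ℝ (s '' {η | η ≠ ξ}))

/-- A simplex of `H^{p,q}`: a polytope with `p + q + 1` vertices, which span `ℝ^{p,q+1}`. -/
def IsSimplex (Λ : Set (ℙ ℝ (PQ p q))) : Prop :=
  IsPolytope Λ ∧ Λ.ncard = p + q + 1 ∧ ⨆ ξ ∈ Λ, Projectivization.submodule ξ = ⊤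

/-- The projective boundary of `H^{p,q}`: the set of isotropic lines. -/
def boundary (p q : ℕ) : Set (ℙ ℝ (PQ p q)) := {ξ | b ξ.rep ξ.rep = 0}

/-- A set of points of projective space is ideal if it lies in the boundary of `H^{p,q}`. -/
def IsIdeal (Λ : Set (ℙ ℝ (PQ p q))) : Prop := Λ ⊆ boundary p q

end PseudoHyperbolic

end

/-! Five independent isotropic vectors of `ℝ^{2,3}` have a Gram matrix with zero diagonal and
negative determinant (`det_gram`). When its entries are nonpositive, a negative term of the Leibniz
expansion comes from an even permutation without fixed points. On five points this is a 5-cycle,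
since the other fixed-point-free type, 3+2, is odd. So the vertices can be ordered cyclically with
all consecutive products nonzero (`exists_hamiltonian_cycle`).

Write a point of the open cone as the sum of `exp(wₖ) eₖ`. As 5 is odd, the consecutive sums of the
`wₖ` determine them; scaling the vector makes one sum zero, and the others are `2 uᵢ`. The cycle
then gives `Q = -b(x,x) ≥ c` and `Q ≥ c exp(2 uᵢ)` (`exists_le_neg_b_expSum`). The volume density is
a constant times `exp(∑ uᵢ) Q^(-5/2)` (`abs_det_metricMatrix_expParam`), and these bounds make it
decay exponentially in `∑ |uᵢ|` (`exp_sum_mul_expScale_pow_le`), so it is integrable. -/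

noncomputable section
namespace PseudoHyperbolic
variable {p q : ℕ}

/-! ### The bilinear form and Gram determinants -/

/-- The form `b` as a bilinear form. -/
def bilin (p q : ℕ) : LinearMap.BilinForm ℝ (PQ p q) :=
  LinearMap.mk₂ ℝ b
    (fun x y z => by simp only [b, Pi.add_apply, add_mul, Finset.sum_add_distrib]; ring)
    (fun c x y => by
      simp only [b, Pi.smul_apply, smul_eq_mul, mul_assoc, ← Finset.mul_sum]; ring)
    (fun x y z => by simp only [b, Pi.add_apply, mul_add, Finset.sum_add_distrib]; ring)
    (fun c x y => by
      simp only [b, Pi.smul_apply, smul_eq_mul, mul_left_comm _ c, ← Finset.mul_sum]; ring)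

@[simp] lemma bilin_apply (x y : PQ p q) : bilin p q x y = b x y := rfl

lemma b_comm (x y : PQ p q) : b x y = b y x := by simp [b, mul_comm]

lemma b_smul_smul (c d : ℝ) (x y : PQ p q) : b (c • x) (d • y) = c * d * b x y := by
  simp only [← bilin_apply, map_smul, LinearMap.smul_apply, smul_eq_mul]
  ring

lemma b_sum_smul {ι ι' : Type*} [Fintype ι] [Fintype ι'] (s : ι → ℝ) (t : ι' → ℝ)
    (e : ι → PQ p q) (e' : ι' → PQ p q) :
    b (∑ k, s k • e k) (∑ l, t l • e' l) = ∑ k, ∑ l, s k * b (e k) (e' l) * t l := by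
  rw [← bilin_apply]
  simp only [map_sum, map_smul, LinearMap.sum_apply, LinearMap.smul_apply, bilin_apply,
    smul_eq_mul, Finset.mul_sum]
  rw [Finset.sum_comm]
  exact Finset.sum_congr rfl fun k _ => Finset.sum_congr rfl fun l _ => by ring

/-- The Gram matrix of a family of vectors. -/
def gram {ι : Type*} (e : ι → PQ p q) : Matrix ι ι ℝ := Matrix.of fun i j => b (e i) (e j)

lemma gram_linearCombination {ι κ : Type*} [Fintype κ] (e : κ → PQ p q)
    (P : Matrix κ ι ℝ) :
    gram (fun j => ∑ k, P k j • e k) = P.transpose * gram e * P := by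
  ext i j
  simp only [gram, Matrix.of_apply, b_sum_smul, Matrix.mul_apply, Matrix.transpose_apply,
    Finset.sum_mul]
  rw [Finset.sum_comm]

/-- The Gram matrix factors as `M D Mᵀ` with `D` the diagonal matrix of signs, so the signature
alone decides the sign of the determinant. -/
lemma det_gram {ι : Type*} [Fintype ι] [DecidableEq ι] (f : ι ≃ Fin p ⊕ Fin (q + 1))
    (e : ι → PQ p q) :
    (gram e).det = (-1) ^ (q + 1) * (Matrix.of fun i j => e i (f j)).det ^ 2 := by
  set M : Matrix ι ι ℝ := Matrix.of fun i j => e i (f j)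
  set d : Fin p ⊕ Fin (q + 1) → ℝ := Sum.elim (fun _ => 1) (fun _ => -1)
  have h : gram e = M * Matrix.diagonal (fun i => d (f i)) * M.transpose := by
    ext i j
    rw [Matrix.mul_apply]
    simp only [Matrix.mul_diagonal, Matrix.transpose_apply, M, Matrix.of_apply, gram]
    rw [f.sum_comp (fun k => e i k * d k * e j k)]
    simp [b, d, sub_eq_add_neg]
  rw [h, Matrix.det_mul, Matrix.det_mul, Matrix.det_transpose, Matrix.det_diagonal,
    f.prod_comp d]
  simp [d]
  ring

lemma det_gram_neg_of_linearIndependent {ι : Type*} [Fintype ι] [DecidableEq ι]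
    (hq : Even q) (f : ι ≃ Fin p ⊕ Fin (q + 1)) {e : ι → PQ p q} (he : LinearIndependent ℝ e) :
    (gram e).det < 0 := by
  rw [det_gram f, hq.add_one.neg_one_pow, neg_one_mul, neg_lt_zero, sq_pos_iff]
  have h : LinearIndependent ℝ (Matrix.of fun i j => e i (f j)).row :=
    he.map' (LinearEquiv.funCongrLeft ℝ ℝ f).toLinearMap (LinearEquiv.ker _)
  exact ((Matrix.isUnit_iff_isUnit_det _).1 (Matrix.linearIndependent_rows_iff_isUnit.1 h)).ne_zero

/-! ### Hamiltonian cycles from the Leibniz expansion -/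

/-- An even permutation of five points without fixed points is a `5`-cycle. -/
lemma perm_five_isCycle : ∀ σ : Equiv.Perm (Fin 5), Equiv.Perm.sign σ = 1 → (∀ i, σ i ≠ i) →
    Function.Injective (fun i : Fin 5 => (σ ^ (i : ℕ)) 0) ∧ (σ ^ 5) 0 = 0 := by
  decide +kernel

/-- A nonpositive `5 × 5` matrix with zero diagonal and negative determinant has a Hamiltonian
cycle of nonzero entries. -/
lemma exists_hamiltonian_cycle (A : Matrix (Fin 5) (Fin 5) ℝ) (hdiag : ∀ i, A i i = 0)
    (hA : ∀ i j, A i j ≤ 0) (hdet : A.det < 0) :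
    ∃ c : Fin 5 → Fin 5, Function.Injective c ∧ ∀ i, A (c i) (c (i + 1)) < 0 := by
  rw [← Matrix.det_transpose, Matrix.det_apply'] at hdet
  obtain ⟨σ, -, hσ⟩ := Finset.exists_lt_of_sum_lt (hdet.trans_eq Finset.sum_const_zero.symm)
  simp only [Matrix.transpose_apply] at hσ
  have hprod : ∏ i, A i (σ i) ≠ 0 := fun h => by simp [h] at hσ
  have hneg : ∀ i, A i (σ i) < 0 := fun i =>
    lt_of_le_of_ne (hA _ _) (Finset.prod_ne_zero_iff.1 hprod i (Finset.mem_univ i))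
  have hpos : 0 < ∏ i, -A i (σ i) := Finset.prod_pos fun i _ => neg_pos.2 (hneg i)
  rw [Finset.prod_neg] at hpos
  -- Five negative factors have a negative product, so an odd permutation would contribute a
  -- positive term.
  have hsign : Equiv.Perm.sign σ = 1 := by
    rcases Int.units_eq_one_or (Equiv.Perm.sign σ) with h | h
    · exact h
    · rw [h] at hσ
      norm_num at hσ hpos
      linarith
  obtain ⟨hinj, h5⟩ := perm_five_isCycle σ hsign fun i h => by
    have := hneg i
    rw [h, hdiag] at this
    exact this.false
  refine ⟨fun i => (σ ^ (i : ℕ)) 0, hinj, fun i => ?_⟩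
  -- At `i = 4` the index wraps around to `0`, which is where `σ ^ 5` fixing `0` enters.
  have hstep : (σ ^ ((i + 1 : Fin 5) : ℕ)) 0 = σ ((σ ^ (i : ℕ)) 0) := by
    rw [← Equiv.Perm.mul_apply, ← pow_succ']
    fin_cases i
    all_goals first | rfl | exact h5.symm
  change A _ ((σ ^ ((i + 1 : Fin 5) : ℕ)) 0) < 0
  rw [hstep]
  exact hneg _


/-! ### Log-linear coordinates on a simplicial cone -/

/-- The vector with coordinates `exp (W u)ₖ` in the basis `e`. -/
def expSum (W : Matrix (Fin (p + q) ⊕ Unit) (Fin (p + q)) ℝ) (e : Fin (p + q) ⊕ Unit → PQ p q)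
    (u : Fin (p + q) → ℝ) : PQ p q :=
  ∑ k, Real.exp (W.mulVec u k) • e k

/-- The factor that normalizes `expSum` to the quadric. -/
def expScale (W : Matrix (Fin (p + q) ⊕ Unit) (Fin (p + q)) ℝ)
    (e : Fin (p + q) ⊕ Unit → PQ p q) (u : Fin (p + q) → ℝ) : ℝ :=
  (√(-b (expSum W e u) (expSum W e u)))⁻¹

/-- The normalization of `expSum` to the quadric. -/
def expMap (W : Matrix (Fin (p + q) ⊕ Unit) (Fin (p + q)) ℝ)
    (e : Fin (p + q) ⊕ Unit → PQ p q) (u : Fin (p + q) → ℝ) : PQ p q :=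
  expScale W e u • expSum W e u

section ExpMap

variable {W : Matrix (Fin (p + q) ⊕ Unit) (Fin (p + q)) ℝ} {e : Fin (p + q) ⊕ Unit → PQ p q}

lemma hasFDerivAt_expSum (u : Fin (p + q) → ℝ) :
    HasFDerivAt (expSum W e) (∑ k, (Real.exp (W.mulVec u k) •
      (LinearMap.toContinuousLinearMap (LinearMap.proj k ∘ₗ W.mulVecLin))).smulRight (e k)) u := by
  refine HasFDerivAt.fun_sum fun k _ => ?_
  exact (((LinearMap.toContinuousLinearMap
    (LinearMap.proj k ∘ₗ W.mulVecLin)).hasFDerivAt (x := u)).exp).smul_const (e k)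

lemma contDiff_expSum : ContDiff ℝ ∞ (expSum W e) := by
  refine ContDiff.sum fun k _ => ContDiff.fun_smul ?_ contDiff_const
  exact (LinearMap.toContinuousLinearMap (LinearMap.proj k ∘ₗ W.mulVecLin)).contDiff.exp

lemma contDiff_b_expSum : ContDiff ℝ ∞ fun u => b (expSum W e u) (expSum W e u) := by
  have h := contDiff_pi.1 (contDiff_expSum (W := W) (e := e))
  unfold b
  exact (ContDiff.sum fun i _ => (h _).mul (h _)).sub (ContDiff.sum fun i _ => (h _).mul (h _))

lemma expScale_pos {u : Fin (p + q) → ℝ} (hu : b (expSum W e u) (expSum W e u) < 0) :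
    0 < expScale W e u :=
  inv_pos.2 (Real.sqrt_pos.2 (neg_pos.2 hu))

lemma b_expMap {u : Fin (p + q) → ℝ} (hu : b (expSum W e u) (expSum W e u) < 0) :
    b (expMap W e u) (expMap W e u) = -1 := by
  have h : √(-b (expSum W e u) (expSum W e u)) ^ 2 = -b (expSum W e u) (expSum W e u) :=
    Real.sq_sqrt (neg_pos.2 hu).le
  have h' := (Real.sqrt_pos.2 (neg_pos.2 hu)).ne'
  rw [expMap, b_smul_smul, expScale]
  field_simp
  linarith

variable (hneg : ∀ u, b (expSum W e u) (expSum W e u) < 0)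

include hneg in
lemma contDiff_expScale : ContDiff ℝ ∞ (expScale W e) :=
  (contDiff_b_expSum.neg.sqrt fun u => (neg_pos.2 (hneg u)).ne').inv
    fun u => (Real.sqrt_pos.2 (neg_pos.2 (hneg u))).ne'

include hneg in
lemma contDiff_expMap : ContDiff ℝ ∞ (expMap W e) :=
  (contDiff_expScale hneg).smul contDiff_expSum

include hneg in
lemma fderiv_expMap_apply (u v : Fin (p + q) → ℝ) :
    fderiv ℝ (expMap W e) u v = ∑ k, (Real.exp (W.mulVec u k) *
      (W.mulVec v k * expScale W e u + fderiv ℝ (expScale W e) u v)) • e k := by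
  have h := ((contDiff_expScale hneg).differentiable (by simp) u).hasFDerivAt.smul
    (hasFDerivAt_expSum (W := W) (e := e) u)
  have h' : HasFDerivAt (expMap W e) _ u := h
  rw [h'.fderiv]
  simp only [add_apply, smul_apply,
    sum_apply, ContinuousLinearMap.smulRight_apply,
    LinearMap.coe_toContinuousLinearMap', LinearMap.comp_apply, LinearMap.proj_apply,
    Matrix.mulVecLin_apply, expSum, Finset.smul_sum, smul_smul, smul_eq_mul,
    ← Finset.sum_add_distrib, ← add_smul]
  refine Finset.sum_congr rfl fun k _ => ?_
  congr 1
  ring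

include hneg in
-- Differentiate the constant function `b(φ, φ) = -1`.
lemma b_fderiv_expMap (u v : Fin (p + q) → ℝ) :
    b (fderiv ℝ (expMap W e) u v) (expMap W e u) = 0 := by
  have hd := ((contDiff_expMap hneg).differentiable (by simp) u).hasFDerivAt
  have h := (LinearMap.toContinuousBilinearMap (bilin p q)).hasFDerivAt_of_bilinear hd hd
  have hc : HasFDerivAt (fun u => b (expMap W e u) (expMap W e u))
      (0 : (Fin (p + q) → ℝ) →L[ℝ] ℝ) u := by
    simp only [b_expMap (hneg _)]
    exact hasFDerivAt_const _ _
  have h' := congrArg (fun D => D v) (h.unique hc)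
  simp at h'
  linarith [b_comm (fderiv ℝ (expMap W e) u v) (expMap W e u)]

variable (he : LinearIndependent ℝ e) (hW : ∀ v c, (∀ k, W.mulVec v k = c) → v = 0)

/-- The parametrization by `expMap`. -/
def expParam (hneg : ∀ u, b (expSum W e u) (expSum W e u) < 0) (he : LinearIndependent ℝ e)
    (hW : ∀ v c, (∀ k, W.mulVec v k = c) → v = 0) : Parametrization p q where
  source := Set.univ
  toFun := expMap W e
  isOpen_source := isOpen_univ
  contDiffOn := (contDiff_expMap hneg).contDiffOn
  mem_quadric u _ := b_expMap (hneg u)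
  immersive u _ := by
    rw [injective_iff_map_eq_zero]
    intro v hv
    rw [fderiv_expMap_apply hneg] at hv
    -- In the basis `e`, every coefficient of the derivative vanishes, so `W v` has all its entries
    -- equal to this quotient.
    refine hW v (-fderiv ℝ (expScale W e) u v / expScale W e u) fun k => ?_
    have h := Fintype.linearIndependent_iff.1 he _ hv k
    have hr := (expScale_pos (hneg u)).ne'
    have h' := (mul_eq_zero.1 h).resolve_left (Real.exp_pos _).ne'
    field_simp
    linarith
  injective u _ v _ h := by
    have key : ∀ c : ℝ, expMap W e u = c • expMap W e v → 0 ≤ c → u = v := by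
      intro c hc hc0
      have hru := expScale_pos (hneg u)
      have hrv := expScale_pos (hneg v)
      simp only [expMap, expSum, Finset.smul_sum, smul_smul] at hc
      have hk : ∀ k, expScale W e u * Real.exp (W.mulVec u k) =
          c * expScale W e v * Real.exp (W.mulVec v k) := by
        intro k
        rw [← sub_eq_zero, ← Finset.sum_sub_distrib] at hc
        simp only [← sub_smul] at hc
        have := Fintype.linearIndependent_iff.1 he _ hc k
        linarith
      rw [← sub_eq_zero]
      refine hW _ (Real.log (c * expScale W e v / expScale W e u)) fun k => ?_
      have : c * expScale W e v / expScale W e u = Real.exp (W.mulVec (u - v) k) := by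
        rw [Matrix.mulVec_sub, Pi.sub_apply, Real.exp_sub,
          div_eq_div_iff hru.ne' (Real.exp_pos _).ne', ← hk k, mul_comm]
      rw [this, Real.log_exp]
    rcases h with h | h
    · exact key 1 (by simpa using h) zero_le_one
    · exfalso
      have hru := expScale_pos (hneg u)
      have hrv := expScale_pos (hneg v)
      simp only [expMap, expSum, Finset.smul_sum, smul_smul] at h
      rw [eq_neg_iff_add_eq_zero, ← Finset.sum_add_distrib] at h
      simp only [← add_smul] at h
      -- Antipodal values are impossible: all coefficients in the basis `e` are positive, and one of
      -- them suffices.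
      have := Fintype.linearIndependent_iff.1 he _ h (Sum.inr ())
      have h1 := mul_pos hru (Real.exp_pos (W.mulVec u (Sum.inr ())))
      have h2 := mul_pos hrv (Real.exp_pos (W.mulVec v (Sum.inr ())))
      linarith

/-- Adjoin the position vector to the coordinate tangent vectors. It is orthogonal to them and has
norm `-1`, so the enlarged Gram determinant is that of the metric up to sign. It also equals
`det(P)² det(gram e)`, where `P` expresses the enlarged family in the basis `e` and splits into a
diagonal factor, `[W | 1]` and a block triangular factor. -/
lemma abs_det_metricMatrix_expParam (u : Fin (p + q) → ℝ) :
    |((expParam hneg he hW).metricMatrix u).det| =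
      ((∏ k, Real.exp (W.mulVec u k)) *
        (Matrix.fromCols W (Matrix.of fun _ _ => 1 : Matrix _ Unit ℝ)).det *
          expScale W e u ^ (p + q + 1)) ^ 2 * |(gram e).det| := by
  set r := expScale W e u
  set dr : Fin (p + q) → ℝ := fun j => fderiv ℝ (expScale W e) u (Pi.single j 1)
  set P : Matrix (Fin (p + q) ⊕ Unit) (Fin (p + q) ⊕ Unit) ℝ :=
    Matrix.diagonal (fun k => Real.exp (W.mulVec u k)) *
      Matrix.fromCols W (Matrix.of fun _ _ => 1 : Matrix _ Unit ℝ) *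
      Matrix.fromBlocks (Matrix.diagonal fun _ => r) 0 (Matrix.of fun _ j => dr j)
        (Matrix.diagonal fun _ => r) with hP
  have hP1 : ∀ j, ∑ k, P k (Sum.inl j) • e k = fderiv ℝ (expMap W e) u (Pi.single j 1) := by
    intro j
    rw [fderiv_expMap_apply hneg]
    refine Finset.sum_congr rfl fun k _ => ?_
    congr 1
    rw [hP, Matrix.mul_assoc, Matrix.diagonal_mul, Matrix.mul_apply, Fintype.sum_sum_type]
    simp [Matrix.diagonal_apply, r, dr]
  have hP2 : ∀ j, ∑ k, P k (Sum.inr j) • e k = expMap W e u := by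
    intro j
    rw [expMap, expSum, Finset.smul_sum]
    refine Finset.sum_congr rfl fun k _ => ?_
    rw [smul_smul]
    congr 1
    rw [hP, Matrix.mul_assoc, Matrix.diagonal_mul, Matrix.mul_apply, Fintype.sum_sum_type]
    simp [r, mul_comm]
  have hG : gram (fun j => ∑ k, P k j • e k) =
      Matrix.fromBlocks ((expParam hneg he hW).metricMatrix u) 0 0
        (Matrix.diagonal fun _ => -1) := by
    ext i j
    rcases i with i | i <;> rcases j with j | j
    · simp only [gram, Matrix.of_apply, hP1]
      rfl
    · simp only [gram, Matrix.of_apply, hP1, hP2]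
      simp [b_fderiv_expMap hneg]
    · simp only [gram, Matrix.of_apply, hP1, hP2]
      simp [b_comm (expMap W e u), b_fderiv_expMap hneg]
    · simp only [gram, Matrix.of_apply, hP2]
      simp [b_expMap (hneg u)]
  have hdet := congrArg Matrix.det ((gram_linearCombination e P).symm.trans hG)
  rw [Matrix.det_fromBlocks_zero₁₂, Matrix.det_mul, Matrix.det_mul, Matrix.det_transpose,
    Matrix.det_diagonal] at hdet
  have hdetP : P.det = (∏ k, Real.exp (W.mulVec u k)) *
        (Matrix.fromCols W (Matrix.of fun _ _ => 1 : Matrix _ Unit ℝ)).det * r ^ (p + q + 1) := by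
    rw [hP, Matrix.det_mul, Matrix.det_mul, Matrix.det_fromBlocks_zero₁₂]
    simp [pow_succ]
  rw [← hdetP, ← abs_of_nonneg (sq_nonneg P.det), ← abs_mul]
  simp at hdet
  rw [← abs_neg, ← hdet]
  congr 1
  ring

end ExpMap


/-! ### Interior points of a projective simplex -/

lemma convexHull_range_subset_cone {ι : Type*} [Fintype ι] (e : ι → PQ p q) :
    convexHull ℝ (Set.range e) ⊆ {x | ∃ t : ι → ℝ, (∀ k, 0 ≤ t k) ∧ x = ∑ k, t k • e k} := by
  classical
  refine convexHull_min ?_ ?_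
  · rintro _ ⟨i, rfl⟩
    refine ⟨Pi.single i 1, fun k => ?_, by simp [Pi.single_apply]⟩
    rw [Pi.single_apply]
    split_ifs <;> norm_num
  · rintro _ ⟨t, ht, rfl⟩ _ ⟨t', ht', rfl⟩ a a' ha ha' -
    refine ⟨fun k => a * t k + a' * t' k,
      fun k => add_nonneg (mul_nonneg ha (ht k)) (mul_nonneg ha' (ht' k)), ?_⟩
    simp only [add_smul, mul_smul, Finset.sum_add_distrib, Finset.smul_sum]

/-- If a coefficient `t k` vanished, the nearby lines through `x - ε eₖ` would leave the
projectivized cone: this vector has a negative coefficient at `k` and a positive one at some `j`, so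
no nonzero multiple of it lies in the cone. -/
lemma interior_projSet_convexHull_subset {ι : Type*} [Fintype ι] {e : ι → PQ p q}
    (he : LinearIndependent ℝ e) {ξ : ℙ ℝ (PQ p q)}
    (hξ : ξ ∈ interior (projSet (convexHull ℝ (Set.range e)))) :
    ∃ t : ι → ℝ, (∀ k, 0 < t k) ∧
      ∃ h : ∑ k, t k • e k ≠ 0, Projectivization.mk ℝ (∑ k, t k • e k) h = ξ := by
  classical
  obtain ⟨x, hx, hx0, rfl⟩ := interior_subset hξ
  obtain ⟨t, ht, rfl⟩ := convexHull_range_subset_cone e hx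
  refine ⟨t, fun k => ?_, hx0, rfl⟩
  by_contra hk
  have hk0 : t k = 0 := le_antisymm (not_lt.1 hk) (ht k)
  obtain ⟨j, hj⟩ : ∃ j, t j ≠ 0 := by
    by_contra! h
    exact hx0 (by simp [h])
  have hjk : j ≠ k := fun h => hj (h ▸ hk0)
  have hcoord : ∀ ε : ℝ, ∑ i, t i • e i - ε • e k =
      ∑ i, (t i - ε * (Pi.single k 1 : ι → ℝ) i) • e i := by
    intro ε
    simp [sub_smul, Finset.sum_sub_distrib, Pi.single_apply]
  have hne : ∀ ε : ℝ, ∑ i, t i • e i - ε • e k ≠ 0 := by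
    intro ε h
    rw [hcoord] at h
    have := Fintype.linearIndependent_iff.1 he _ h j
    simp [hjk] at this
    exact hj this
  have hcont : Continuous fun ε : ℝ => Projectivization.mk ℝ _ (hne ε) := by
    have h1 : Continuous fun ε : ℝ => (⟨_, hne ε⟩ : {v : PQ p q // v ≠ 0}) :=
      Continuous.subtype_mk (by fun_prop) _
    exact continuous_coinduced_rng.comp h1
  have hmem : ∀ᶠ ε in nhds (0 : ℝ), Projectivization.mk ℝ _ (hne ε) ∈
      projSet (convexHull ℝ (Set.range e)) := by
    refine hcont.continuousAt.eventually_mem (mem_interior_iff_mem_nhds.1 ?_)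
    simpa using hξ
  obtain ⟨ε, hε, y, hy, hy0, hmk⟩ :=
    ((hmem.filter_mono nhdsWithin_le_nhds).and (self_mem_nhdsWithin (s := Set.Ioi 0))).exists.imp
      fun ε h => And.symm h
  obtain ⟨a, ha⟩ := (Projectivization.mk_eq_mk_iff' ℝ _ _ _ _).1 hmk
  obtain ⟨t', ht', rfl⟩ := convexHull_range_subset_cone e hy
  rw [hcoord, Finset.smul_sum, ← sub_eq_zero, ← Finset.sum_sub_distrib] at ha
  simp only [smul_smul, ← sub_smul] at ha
  have hcj := Fintype.linearIndependent_iff.1 he _ ha j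
  have hck := Fintype.linearIndependent_iff.1 he _ ha k
  simp only [Pi.single_eq_same, Pi.single_eq_of_ne hjk, hk0] at hcj hck
  have hε' : 0 < ε := hε
  have htj : 0 < t j := lt_of_le_of_ne (ht j) hj.symm
  have ha0 : 0 ≤ a := by
    by_contra h
    nlinarith [ht' j]
  have ha1 : a = 0 := by
    by_contra h
    nlinarith [ht' k, mul_pos (lt_of_le_of_ne ha0 (Ne.symm h)) hε']
  subst ha1
  refine hy0 (Finset.sum_eq_zero fun i _ => ?_)
  have := Fintype.linearIndependent_iff.1 he _ ha i
  rw [zero_mul, zero_sub, neg_eq_zero] at this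
  rw [this, zero_smul]

/-! ### Volume estimates -/

/-- The countable cover is completed by empty pieces. -/
lemma volume_le_vol {A : Set (ℙ ℝ (PQ p q))} (P : Piece p q) (h : A ⊆ P.image) :
    volume A ≤ P.vol := by
  let P' : ℕ → Piece p q := fun n => if n = 0 then P else
    ⟨P.param, ∅, MeasurableSet.empty, Set.empty_subset _⟩
  refine (iInf₂_le P' (h.trans (Set.subset_iUnion_of_subset 0 ?_))).trans ?_
  · simp [P']
  · rw [tsum_eq_single 0]
    · simp [P']
    · intro n hn
      simp [P', hn, Piece.vol]

lemma integrable_exp_neg_abs {a : ℝ} (ha : 0 < a) :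
    MeasureTheory.Integrable fun x : ℝ => Real.exp (-(a * |x|)) := by
  rw [← MeasureTheory.integrableOn_univ, ← Set.Iic_union_Ioi (a := (0 : ℝ))]
  refine MeasureTheory.IntegrableOn.union ?_ ?_
  · refine (integrableOn_exp_mul_Iic ha 0).congr_fun (fun x hx => ?_) measurableSet_Iic
    simp only [abs_of_nonpos (show x ≤ 0 from hx), mul_neg, neg_neg]
  · refine (integrableOn_exp_mul_Ioi (neg_lt_zero.2 ha) 0).congr_fun (fun x hx => ?_)
      measurableSet_Ioi
    simp only [abs_of_pos (show 0 < x from hx), neg_mul]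

lemma integrable_exp_neg_sum_abs {ι : Type*} [Fintype ι] {a : ℝ} (ha : 0 < a) :
    MeasureTheory.Integrable fun u : ι → ℝ => Real.exp (-(a * ∑ i, |u i|)) := by
  have h := MeasureTheory.Integrable.fintype_prod (ι := ι) (μ := fun _ => MeasureTheory.volume)
    fun _ => integrable_exp_neg_abs ha
  simp only [← Real.exp_sum, Finset.sum_neg_distrib, ← Finset.mul_sum] at h
  exact h

/-! ### Cyclic coordinates -/

/-- The weights for which consecutive coordinates of `cycleWeight.mulVec u`, in cyclic order, have
the sums `2 u₀, 2 u₁, 2 u₂, 2 u₃, 0`. -/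
def cycleWeight : Matrix (Fin (2 + 2) ⊕ Unit) (Fin (2 + 2)) ℝ :=
  Matrix.of (Sum.elim ![![1, -1, 1, -1], ![1, 1, -1, 1], ![-1, 1, 1, -1], ![1, -1, 1, 1]]
    fun _ => ![-1, 1, -1, 1])

lemma cycleWeight_mulVec (u : Fin (2 + 2) → ℝ) :
    cycleWeight.mulVec u = Sum.elim ![u 0 - u 1 + u 2 - u 3, u 0 + u 1 - u 2 + u 3,
      -u 0 + u 1 + u 2 - u 3, u 0 - u 1 + u 2 + u 3] fun _ => -u 0 + u 1 - u 2 + u 3 := by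
  ext k
  rcases k with k | k
  · fin_cases k <;>
      simp [Matrix.mulVec, dotProduct, cycleWeight, Fin.sum_univ_four] <;> ring
  · simp [Matrix.mulVec, dotProduct, cycleWeight, Fin.sum_univ_four]
    ring

lemma eq_zero_of_cycleWeight_mulVec (v : Fin (2 + 2) → ℝ) (c : ℝ)
    (h : ∀ k, cycleWeight.mulVec v k = c) : v = 0 := by
  simp only [cycleWeight_mulVec, Sum.forall, Fin.forall_fin_succ] at h
  simp at h
  obtain ⟨⟨h0, h1, h2, h3⟩, h4⟩ := h
  ext i
  fin_cases i <;> simp <;> linarith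

lemma sum_cycleWeight_mulVec (u : Fin (2 + 2) → ℝ) :
    ∑ k, cycleWeight.mulVec u k = ∑ i, u i := by
  rw [cycleWeight_mulVec, Fintype.sum_sum_type, Fin.sum_univ_four, Fin.sum_univ_four]
  simp
  ring

lemma exists_exp_cycleWeight (t : Fin (2 + 2) ⊕ Unit → ℝ) (ht : ∀ k, 0 < t k) :
    ∃ (u : Fin (2 + 2) → ℝ) (a : ℝ), 0 < a ∧
      ∀ k, t k = a * Real.exp (cycleWeight.mulVec u k) := by
  set τ : Fin (2 + 2) ⊕ Unit → ℝ := fun k => Real.log (t k) with hτ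
  -- Scaling by `exp d` makes the consecutive sum that closes the cycle equal to zero.
  set d : ℝ := (τ (Sum.inl 0) + τ (Sum.inr ())) / 2 with hd
  refine ⟨![(τ (Sum.inl 0) + τ (Sum.inl 1)) / 2 - d, (τ (Sum.inl 1) + τ (Sum.inl 2)) / 2 - d,
    (τ (Sum.inl 2) + τ (Sum.inl 3)) / 2 - d, (τ (Sum.inl 3) + τ (Sum.inr ())) / 2 - d],
    Real.exp d, Real.exp_pos d, fun k => ?_⟩
  have ht' : t k = Real.exp (τ k) := (Real.exp_log (ht k)).symm
  rw [ht', ← Real.exp_add, cycleWeight_mulVec]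
  congr 1
  rcases k with k | k
  · fin_cases k <;> simp [hd] <;> ring
  · simp [hd]
    ring

/-- The numbering of the five coordinates in cyclic order. -/
def cycleIndex : Fin (2 + 2) ⊕ Unit ≃ Fin 5 :=
  ((Equiv.refl (Fin 4)).sumCongr finOneEquiv.symm).trans finSumFinEquiv

lemma exists_cyclic_numbering {ι : Type*} [Fintype ι] (hι : Fintype.card ι = 5)
    {e : ι → PQ 2 2} (he : LinearIndependent ℝ e) (h0 : ∀ i, b (e i) (e i) = 0)
    (hle : ∀ i j, b (e i) (e j) ≤ 0) :
    ∃ g : Fin 5 ≃ ι, ∀ i, b (e (g i)) (e (g (i + 1))) < 0 := by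
  let f : Fin 5 ≃ ι := (Fintype.equivFinOfCardEq hι).symm
  obtain ⟨c, hc, hneg⟩ := exists_hamiltonian_cycle (gram fun i => e (f i)) (fun i => h0 _)
    (fun i j => hle _ _) (det_gram_neg_of_linearIndependent even_two finSumFinEquiv.symm
      (he.comp f f.injective))
  exact ⟨(Equiv.ofBijective c (Finite.injective_iff_bijective.1 hc)).trans f, hneg⟩

/-! ### Lower bounds for the form and exponential decay of the density -/

lemma mul_mul_le_neg_b_expSum {W : Matrix (Fin (p + q) ⊕ Unit) (Fin (p + q)) ℝ}
    {e : Fin (p + q) ⊕ Unit → PQ p q} (hle : ∀ k l, b (e k) (e l) ≤ 0) (u : Fin (p + q) → ℝ)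
    (k l : Fin (p + q) ⊕ Unit) :
    -b (e k) (e l) * Real.exp (W.mulVec u k + W.mulVec u l) ≤
      -b (expSum W e u) (expSum W e u) := by
  rw [expSum, b_sum_smul, ← Finset.sum_neg_distrib]
  simp only [← Finset.sum_neg_distrib]
  have hnn : ∀ k l,
      0 ≤ -(Real.exp (W.mulVec u k) * b (e k) (e l) * Real.exp (W.mulVec u l)) := fun k l => by
    have := mul_nonneg (mul_nonneg (Real.exp_pos (W.mulVec u k)).le (neg_nonneg.2 (hle k l)))
      (Real.exp_pos (W.mulVec u l)).le
    linarith
  refine le_trans (le_of_eq ?_) ((Finset.single_le_sum (fun l _ => hnn k l)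
    (Finset.mem_univ l)).trans (Finset.single_le_sum
      (fun k _ => Finset.sum_nonneg fun l _ => hnn k l) (Finset.mem_univ k)))
  rw [Real.exp_add]
  ring

lemma exists_le_neg_b_expSum {e : Fin (2 + 2) ⊕ Unit → PQ 2 2}
    (hle : ∀ k l, b (e k) (e l) ≤ 0)
    (hcyc : ∀ i : Fin 5, b (e (cycleIndex.symm i)) (e (cycleIndex.symm (i + 1))) < 0) :
    ∃ c : ℝ, 0 < c ∧ ∀ u, c ≤ -b (expSum cycleWeight e u) (expSum cycleWeight e u) ∧
      ∀ i, c * Real.exp (2 * u i) ≤ -b (expSum cycleWeight e u) (expSum cycleWeight e u) := by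
  -- The constant `c` is the smallest of the five values of `-b` along the cycle.
  obtain ⟨i₀, hi₀⟩ := Finite.exists_min
    fun i : Fin 5 => -b (e (cycleIndex.symm i)) (e (cycleIndex.symm (i + 1)))
  refine ⟨_, neg_pos.2 (hcyc i₀), fun u => ?_⟩
  have key : ∀ (i : Fin 5) (y : ℝ), cycleWeight.mulVec u (cycleIndex.symm i) +
      cycleWeight.mulVec u (cycleIndex.symm (i + 1)) = y →
      -b (e (cycleIndex.symm i₀)) (e (cycleIndex.symm (i₀ + 1))) * Real.exp y ≤
        -b (expSum cycleWeight e u) (expSum cycleWeight e u) := by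
    rintro i _ rfl
    exact (mul_le_mul_of_nonneg_right (hi₀ i) (Real.exp_pos _).le).trans
      (mul_mul_le_neg_b_expSum hle u _ _)
  have c0 : cycleIndex.symm 0 = Sum.inl 0 := rfl
  have c1 : cycleIndex.symm 1 = Sum.inl 1 := rfl
  have c2 : cycleIndex.symm 2 = Sum.inl 2 := rfl
  have c3 : cycleIndex.symm 3 = Sum.inl 3 := rfl
  have c4 : cycleIndex.symm 4 = Sum.inr () := rfl
  refine ⟨?_, fun i => key i.castSucc _ ?_⟩
  -- The closing edge has exponent zero, which gives the bound independent of `u`.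
  · have := key 4 0 ?_
    · simpa using this
    · rw [show (4 : Fin 5) + 1 = 0 from rfl, c4, c0, cycleWeight_mulVec]
      simp
  · rw [cycleWeight_mulVec]
    fin_cases i
    · change Sum.elim _ _ (cycleIndex.symm 0) + Sum.elim _ _ (cycleIndex.symm 1) = _
      simp [c0, c1]
      ring
    · change Sum.elim _ _ (cycleIndex.symm 1) + Sum.elim _ _ (cycleIndex.symm 2) = _
      simp [c1, c2]
      ring
    · change Sum.elim _ _ (cycleIndex.symm 2) + Sum.elim _ _ (cycleIndex.symm 3) = _
      simp [c2, c3]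
      ring
    · change Sum.elim _ _ (cycleIndex.symm 3) + Sum.elim _ _ (cycleIndex.symm 4) = _
      simp [c3, c4]
      ring

/-- Put `Q = c exp(2m)`. The two bounds say that `m ≥ 0` and `m ≥ uᵢ`, and the left side is a
constant times `exp(∑ uᵢ - 5m)`. -/
lemma exp_sum_mul_expScale_pow_le {W : Matrix (Fin (2 + 2) ⊕ Unit) (Fin (2 + 2)) ℝ}
    {e : Fin (2 + 2) ⊕ Unit → PQ 2 2} {c : ℝ} (hc : 0 < c) {u : Fin (2 + 2) → ℝ}
    (h0 : c ≤ -b (expSum W e u) (expSum W e u))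
    (h : ∀ i, c * Real.exp (2 * u i) ≤ -b (expSum W e u) (expSum W e u)) :
    Real.exp (∑ i, u i) * expScale W e u ^ 5 ≤
      (√c)⁻¹ ^ 5 * Real.exp (-(1 / 4 * ∑ i, |u i|)) := by
  set Q := -b (expSum W e u) (expSum W e u) with hQ
  have hQ0 : 0 < Q := hc.trans_le h0
  set m := Real.log (Q / c) / 2 with hm
  have hQm : Q = c * Real.exp m ^ 2 := by
    rw [← Real.exp_nat_mul, hm]
    push_cast
    rw [mul_div_cancel₀ _ two_ne_zero, Real.exp_log (div_pos hQ0 hc), mul_div_cancel₀ _ hc.ne']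
  have hm0 : 0 ≤ m := div_nonneg (Real.log_nonneg ((one_le_div hc).2 h0)) two_pos.le
  have hmu : ∀ i, u i ≤ m := by
    intro i
    rw [hm, le_div_iff₀ two_pos, Real.le_log_iff_exp_le (div_pos hQ0 hc), le_div_iff₀ hc,
      mul_comm, mul_comm (u i)]
    exact h i
  have hr : expScale W e u = (√c)⁻¹ * Real.exp (-m) := by
    rw [expScale, ← hQ, hQm, Real.sqrt_mul hc.le, Real.sqrt_sq (Real.exp_pos m).le, mul_inv,
      Real.exp_neg]
  rw [hr, mul_pow, mul_left_comm, ← Real.exp_nat_mul, ← Real.exp_add]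
  refine mul_le_mul_of_nonneg_left (Real.exp_le_exp.2 ?_) (by positivity)
  -- The exponent `5m` is shared equally among the four coordinates; the surplus `m / 4` over `m`
  -- yields the decay when `uᵢ ≥ 0`.
  have hi : ∀ i, 1 / 4 * |u i| ≤ 5 / 4 * m - u i := by
    intro i
    rcases abs_cases (u i) with ⟨h1, h2⟩ | ⟨h1, h2⟩ <;> rw [h1] <;> linarith [hmu i]
  rw [Fin.sum_univ_four, Fin.sum_univ_four]
  push_cast
  linarith [hi 0, hi 1, hi 2, hi 3]

theorem volume_interior_projSet_convexHull_lt_top {e : Fin (2 + 2) ⊕ Unit → PQ 2 2}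
    (he : LinearIndependent ℝ e) (hle : ∀ k l, b (e k) (e l) ≤ 0)
    (hcyc : ∀ i : Fin 5, b (e (cycleIndex.symm i)) (e (cycleIndex.symm (i + 1))) < 0) :
    volume (interior (projSet (convexHull ℝ (Set.range e)))) < ⊤ := by
  obtain ⟨c, hc, hbound⟩ := exists_le_neg_b_expSum hle hcyc
  have hneg : ∀ u, b (expSum cycleWeight e u) (expSum cycleWeight e u) < 0 := fun u =>
    neg_pos.1 (hc.trans_le (hbound u).1)
  let P : Piece 2 2 := ⟨expParam hneg he eq_zero_of_cycleWeight_mulVec, Set.univ,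
    MeasurableSet.univ, Set.subset_univ _⟩
  refine (volume_le_vol P ?_).trans_lt ?_
  · intro ξ hξ
    obtain ⟨t, ht, hne, rfl⟩ := interior_projSet_convexHull_subset he hξ
    obtain ⟨u, a, ha, hta⟩ := exists_exp_cycleWeight t ht
    have hr := expScale_pos (hneg u)
    have hx : expMap cycleWeight e u = (expScale cycleWeight e u / a) • ∑ k, t k • e k := by
      rw [expMap, expSum, Finset.smul_sum, Finset.smul_sum]
      refine Finset.sum_congr rfl fun k _ => ?_
      rw [smul_smul, smul_smul, hta k]
      congr 1
      field_simp
    have hx0 : expMap cycleWeight e u ≠ 0 := by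
      rw [hx]
      exact smul_ne_zero (div_pos hr ha).ne' hne
    exact ⟨_, ⟨u, Set.mem_univ u, rfl⟩, hx0,
      (Projectivization.mk_eq_mk_iff' ℝ _ _ _ _).2 ⟨_, hx.symm⟩⟩
  · set D := (Matrix.fromCols cycleWeight (Matrix.of fun _ _ => 1 : Matrix _ Unit ℝ)).det
    set K := |D| * √|(gram e).det| * (√c)⁻¹ ^ 5 with hK
    have hint := (integrable_exp_neg_sum_abs (ι := Fin (2 + 2))
      (show (0 : ℝ) < 1 / 4 by norm_num)).const_mul K
    refine lt_of_le_of_lt (MeasureTheory.lintegral_mono fun u => ENNReal.ofReal_le_ofReal ?_)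
      (by simpa [P] using hint.lintegral_lt_top)
    have hdet := abs_det_metricMatrix_expParam hneg he eq_zero_of_cycleWeight_mulVec u
    change √|((expParam hneg he eq_zero_of_cycleWeight_mulVec).metricMatrix u).det| ≤ _
    rw [hdet, Real.sqrt_mul (sq_nonneg _), Real.sqrt_sq_eq_abs, ← Real.exp_sum,
      sum_cycleWeight_mulVec, abs_mul, abs_mul, Real.abs_exp,
      abs_of_nonneg (pow_nonneg (expScale_pos (hneg u)).le _)]
    calc _ = |D| * √|(gram e).det| *
          (Real.exp (∑ i, u i) * expScale cycleWeight e u ^ 5) := by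
          simp only [D]
          ring
      _ ≤ |D| * √|(gram e).det| * ((√c)⁻¹ ^ 5 * Real.exp (-(1 / 4 * ∑ i, |u i|))) :=
        mul_le_mul_of_nonneg_left
          (exp_sum_mul_expScale_pow_le hc (hbound u).1 (hbound u).2) (by positivity)
      _ = _ := by rw [hK]; ring

/-! ### Lifts of simplices -/

lemma IsLift.linearIndependent {Λ : Set (ℙ ℝ (PQ p q))} {s : Λ → PQ p q} (hs : IsLift Λ s)
    [Fintype Λ] (hcard : Λ.ncard = p + q + 1)
    (hspan : ⨆ ξ ∈ Λ, Projectivization.submodule ξ = ⊤) : LinearIndependent ℝ s := by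
  refine linearIndependent_of_top_le_span_of_card_eq_finrank ?_ ?_
  · rw [← hspan]
    refine iSup₂_le fun ξ hξ => ?_
    obtain ⟨h, hmk⟩ := hs ⟨ξ, hξ⟩
    change _ = ξ at hmk
    rw [← hmk, Projectivization.submodule_mk]
    exact Submodule.span_mono (by rintro _ rfl; exact ⟨_, rfl⟩)
  · rw [← Nat.card_eq_fintype_card, Nat.card_coe_set_eq, hcard]
    simp [add_assoc]

lemma IsLift.b_self_eq_zero {Λ : Set (ℙ ℝ (PQ p q))} {s : Λ → PQ p q} (hs : IsLift Λ s)
    (hΛ : IsIdeal Λ) (ξ : Λ) : b (s ξ) (s ξ) = 0 := by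
  obtain ⟨h, hmk⟩ := hs ξ
  have hrep : b (ξ : ℙ ℝ (PQ p q)).rep (ξ : ℙ ℝ (PQ p q)).rep = 0 := hΛ ξ.2
  obtain ⟨a, ha⟩ := (Projectivization.mk_eq_mk_iff' ℝ (s ξ) _ h (Projectivization.rep_nonzero _)).1
    (hmk.trans (Projectivization.mk_rep _).symm)
  rw [← ha, b_smul_smul, hrep, mul_zero]

end PseudoHyperbolic
end

theorem mainTheorem2 (Λ : Set (ℙ ℝ (PseudoHyperbolic.PQ 2 2)))
    (hΛ : PseudoHyperbolic.IsSimplex Λ) (hideal : PseudoHyperbolic.IsIdeal Λ)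
    (s : Λ → PseudoHyperbolic.PQ 2 2) (hs : PseudoHyperbolic.IsPositiveLift Λ s) :
    PseudoHyperbolic.volume (PseudoHyperbolic.Conv s) < ⊤ := by
  obtain ⟨⟨hfin, -⟩, hcard, hspan⟩ := hΛ
  obtain ⟨hlift, -, hle⟩ := hs
  have : Fintype Λ := hfin.fintype
  have hli := hlift.linearIndependent hcard hspan
  obtain ⟨g, hg⟩ := PseudoHyperbolic.exists_cyclic_numbering
    (by rw [← Nat.card_eq_fintype_card, Nat.card_coe_set_eq, hcard]) hli
    (hlift.b_self_eq_zero hideal) hle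
  let f := PseudoHyperbolic.cycleIndex.trans g
  have h := PseudoHyperbolic.volume_interior_projSet_convexHull_lt_top
    (e := fun k => s (f k)) (hli.comp f f.injective) (fun k l => hle _ _)
    fun i => by simpa [f] using hg i
  have hrange : Set.range (fun k => s (f k)) = Set.range s := f.surjective.range_comp s
  rwa [hrange] at h
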